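/- Let $(\Omega,\mathcal F,\mathbb P)$ be a probability space and $\sigma:\Omega\to\Omega$ an invertible, ergodic, $\mathbb P$-preserving transformation. Let $m$ be Lebesgue measure on $X=[0,1]$, let $\operatorname{var}(g)$ be the infimum of the total variations on $[0,1]$ of the functions $h$ with $h=g$ $m$-a.e., let $BV$ be the space of $\varphi\in L^1(m)$ with $\operatorname{var}(\varphi)<\infty$, and put $\|\varphi\|_{BV}=\operatorname{var}(\varphi)+\|\varphi\|_1$. Let $(f_\omega)_{\omega\in\Omega}$ be a measurable family (that is, $(\omega,x)\mapsto f_\omega(x)$ is measurable) of piecewise $C^2$ maps of $[0,1]$ into itself: for each $\omega$ there is a finite partition of $[0,1]$ into intervals such that $f_\omega$ is strictly monotone and $C^2$ in the interior of each of them. Assume that the number of these intervals can be bounded independently of $\omega$, that $\inf_\omega\operatorname{ess\,inf}|f_\omega'|>1$, and that $\sup_\omega\|f_\omega''\|_\infty<\infty$. Let $\mathcal L_\omega$ be the transfer operator of $f_\omega$ on $L^1(m)$, given by $\int(\mathcal L_\omega\phi)\,\psi\,dm=\int\phi\,(\psi\circ f_\omega)\,dm$ for $\phi\in L^1(m)$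 and $\psi\in L^\infty(m)$, and put $\mathcal L_\omega^{(n)}=\mathcal L_{\sigma^{n-1}\omega}\circ\cdots\circ\mathcal L_\omega$ (the identity for $n=0$). Assume moreover: - (H1) $(\omega,x)\mapsto(\mathcal L_\omega H(\omega,\cdot))(x)$ is (has a version that is) $\mathbb P\times m$-measurable for every $\mathbb P\times m$-measurable $H$ with $H(\omega,\cdot)\in L^1(m)$ for a.e. $\omega$. - (Uniform $N$-step Lasota–Yorke inequality) There are $N\ge1$, $\alpha\in(0,1)$ and $C>0$ such that, for a.e. $\omega$ and all $\varphi\in BV$, $\operatorname{var}(\mathcal L_\omega^{(N)}\varphi)\le\alpha\operatorname{var}(\varphi)+C\|\varphi\|_1$. - (H4) There is $N'\in\mathbb N$ such that for each $a>0$ and each sufficiently large $n\in\mathbb N$ there is $c>0$ with $\operatorname{ess\,inf}\mathcal L_\omega^{(N'n)}h\ge\frac c2\|h\|_1$ for a.e. $\omega$ and every $h\in BV$ such that $h\ge0$ and $\operatorname{var}(h)\le a\int h\,dm$. Then there are $K,\lambda>0$ such that, for a.e. $\omega\in\Omega$, all $n\ge0$ and all $\varphi\in BV$ with $\int\varphi\,dm=0$,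 $$\|\mathcal L_\omega^{(n)}\varphi\|_{BV}\le Ke^{-\lambda n}\|\varphi\|_{BV}.$$ -/

import Mathlib

open MeasureTheory Set
open scoped ENNReal

namespace RandomLY

/-- Lebesgue measure on `X = [0,1]`. Functions on `[0,1]` are represented by functions on `ℝ`; only
their values on `[0,1]` matter, and elements of `L¹([0,1])` are handled modulo `=ᵐ[leb]`. -/
noncomputable abbrev leb : Measure ℝ := volume.restrict (Icc (0 : ℝ) 1)

/-- The variation of (the class of) `g`: the infimum, over all `h` that agree with `g` almost
everywhere on `[0,1]`, of the total variation of `h` on `[0,1]`. -/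
noncomputable def var (g : ℝ → ℝ) : ℝ≥0∞ :=
  ⨅ (h : ℝ → ℝ) (_ : h =ᵐ[leb] g), eVariationOn h (Icc (0 : ℝ) 1)

/-- The space `BV`: integrable functions of finite variation. -/
def BV : Set (ℝ → ℝ) := {φ | Integrable φ leb ∧ var φ < ∞}

/-- `‖φ‖_BV = var φ + ‖φ‖₁`, with values in `[0,∞]`; finite for `φ ∈ BV`. -/
noncomputable def bvNorm (φ : ℝ → ℝ) : ℝ≥0∞ := var φ + eLpNorm φ 1 leb

/-- The cone `C_a` of nonnegative `φ ∈ BV` with `var φ ≤ a ∫ φ dm`. -/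
def cone (a : ℝ) : Set (ℝ → ℝ) :=
  {φ | φ ∈ BV ∧ 0 ≤ᵐ[leb] φ ∧ var φ ≤ ENNReal.ofReal (a * ∫ x, φ x ∂leb)}

/-- For nonnegative integrable `φ`, the density with respect to Lebesgue measure of the image
under `f` of the measure `φ dm` (in general only the positive part of `φ` is seen). -/
noncomputable def pushDensity (f φ : ℝ → ℝ) : ℝ → ℝ := fun x =>
  (((leb.withDensity fun y => ENNReal.ofReal (φ y)).map f).rnDeriv leb x).toReal

/-- The transfer operator of a (nonsingular) map `f` of `[0,1]`: the density of the image under `f`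
of the signed measure `φ dm`. It satisfies the usual duality relation, see
`integral_transfer_mul`. -/
noncomputable def transfer (f φ : ℝ → ℝ) : ℝ → ℝ := fun x =>
  pushDensity f φ x - pushDensity f (fun y => -φ y) x

/-- The cocycle `L_ω^{(n)} = L_{σ^{n-1} ω} ∘ ⋯ ∘ L_ω`. -/
noncomputable def transferIter {Ω : Type*} (σ : Ω → Ω) (f : Ω → ℝ → ℝ) :
    ℕ → Ω → (ℝ → ℝ) → (ℝ → ℝ)
  | 0, _, φ => φ
  | n + 1, ω, φ => transfer (f (σ^[n] ω)) (transferIter σ f n ω φ)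

/-- `f` is piecewise monotone and piecewise `C²` on `[0,1]` with (at most) `k` branches: there are
`0 = t₀ < ⋯ < t_k = 1` such that `f` is `C²` and strictly monotone on each `(t_i, t_{i+1})`.
Nothing is asked at the break points. -/
def HasBranches (f : ℝ → ℝ) (k : ℕ) : Prop :=
  ∃ t : Fin (k + 1) → ℝ, StrictMono t ∧ t 0 = 0 ∧ t (Fin.last k) = 1 ∧
    ∀ i : Fin k,
      ContDiffOn ℝ 2 f (Ioo (t i.castSucc) (t i.succ)) ∧
      (StrictMonoOn f (Ioo (t i.castSucc) (t i.succ)) ∨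
        StrictAntiOn f (Ioo (t i.castSucc) (t i.succ)))

/-- Measurability of the random transfer operator: if `H` is `P × m`-measurable with
`H(ω,·) ∈ L¹` for a.e. `ω`, then `(ω, x) ↦ (L_ω H(ω,·))(x)` is `P × m`-measurable. As `L_ω H(ω,·)`
is only a class modulo null sets, this means that it has a `P × m`-measurable version. -/
def MeasurableTransfer {Ω : Type*} [MeasurableSpace Ω] (P : Measure Ω) (f : Ω → ℝ → ℝ) : Prop :=
  ∀ H : Ω → ℝ → ℝ,
    AEStronglyMeasurable (fun p : Ω × ℝ => H p.1 p.2) (P.prod leb) →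
    (∀ᵐ ω ∂P, Integrable (H ω) leb) →
    ∃ G : Ω → ℝ → ℝ, AEStronglyMeasurable (fun p : Ω × ℝ => G p.1 p.2) (P.prod leb) ∧
      ∀ᵐ ω ∂P, G ω =ᵐ[leb] transfer (f ω) (H ω)

/-- A random Lasota–Yorke map on `[0,1]`: a measurable family of piecewise `C²` maps with
measurable transfer operators, a uniform bound on the number of branches, and
`inf_ω essinf |f_ω'| > 1`, `sup_ω ‖f_ω''‖_∞ < ∞`. -/
structure IsRandomLasotaYorke {Ω : Type*} [MeasurableSpace Ω] (P : Measure Ω)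
    (f : Ω → ℝ → ℝ) : Prop where
  measurable : Measurable fun p : Ω × ℝ => f p.1 p.2
  mapsTo : ∀ ω, MapsTo (f ω) (Icc 0 1) (Icc 0 1)
  measurableTransfer : MeasurableTransfer P f
  branches : ∃ b : ℕ, ∀ ω, ∃ k ≤ b, HasBranches (f ω) k
  expanding : ∃ δ : ℝ, 1 < δ ∧ ∀ ω, ∀ᵐ x ∂leb, δ ≤ |deriv (f ω) x|
  bounded_deriv2 : ∃ D : ℝ, ∀ ω, ∀ᵐ x ∂leb, |deriv (deriv (f ω)) x| ≤ D

/-- The uniform `N`-step Lasota–Yorke inequality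
`var (L_ω^{(N)} φ) ≤ α var φ + K ‖φ‖₁` for some `N ≥ 1`, `α ∈ (0,1)`, `K > 0`. -/
def UniformLasotaYorke {Ω : Type*} [MeasurableSpace Ω] (P : Measure Ω) (σ : Ω → Ω)
    (f : Ω → ℝ → ℝ) : Prop :=
  ∃ N : ℕ, 0 < N ∧ ∃ α : ℝ, 0 < α ∧ α < 1 ∧ ∃ K : ℝ, 0 < K ∧
    ∀ᵐ ω ∂P, ∀ φ ∈ BV,
      var (transferIter σ f N ω φ) ≤
        ENNReal.ofReal α * var φ + ENNReal.ofReal K * eLpNorm φ 1 leb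

/-- There is `N` such that for each `a > 0` and all sufficiently large `n` there is `c > 0` with
`essinf L_ω^{(Nn)} h ≥ (c/2) ‖h‖₁` for a.e. `ω` and all `h ∈ C_a`. -/
def UniformMin {Ω : Type*} [MeasurableSpace Ω] (P : Measure Ω) (σ : Ω → Ω)
    (f : Ω → ℝ → ℝ) : Prop :=
  ∃ N : ℕ, ∀ a : ℝ, 0 < a → ∃ n₀ : ℕ, ∀ n ≥ n₀, ∃ c : ℝ, 0 < c ∧
    ∀ᵐ ω ∂P, ∀ h ∈ cone a,
      ∀ᵐ x ∂leb, c / 2 * (∫ y, |h y| ∂leb) ≤ transferIter σ f (N * n) ω h x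

section Duality

theorem map_withDensity_ac {f : ℝ → ℝ} (hf : Measurable f) (hns : leb.map f ≪ leb)
    (g : ℝ → ℝ≥0∞) : (leb.withDensity g).map f ≪ leb :=
  ((withDensity_absolutelyContinuous leb g).map hf).trans hns

theorem isFiniteMeasure_push {φ : ℝ → ℝ} (hφ : Integrable φ leb) (f : ℝ → ℝ) :
    IsFiniteMeasure ((leb.withDensity fun y => ENNReal.ofReal (φ y)).map f) := by
  have : IsFiniteMeasure (leb.withDensity fun y => ENNReal.ofReal (φ y)) :=
    isFiniteMeasure_withDensity_ofReal hφ.2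
  infer_instance

theorem integrable_transfer {φ : ℝ → ℝ} (hφ : Integrable φ leb) (f : ℝ → ℝ) :
    Integrable (transfer f φ) leb := by
  have h1 := isFiniteMeasure_push hφ f
  have h2 := isFiniteMeasure_push hφ.neg f
  exact Measure.integrable_toReal_rnDeriv.sub Measure.integrable_toReal_rnDeriv

theorem integral_pushDensity_mul {f φ ψ : ℝ → ℝ} (hf : Measurable f) (hns : leb.map f ≪ leb)
    (hφ : Integrable φ leb) (hψ : MemLp ψ ∞ leb) :
    ∫ x, pushDensity f φ x * ψ x ∂leb = ∫ x, max (φ x) 0 * ψ (f x) ∂leb := by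
  have h1 := isFiniteMeasure_push hφ f
  have hac := map_withDensity_ac hf hns fun y => ENNReal.ofReal (φ y)
  have e1 := integral_rnDeriv_smul hac (f := ψ)
  simp only [smul_eq_mul] at e1
  unfold pushDensity
  rw [e1, integral_map hf.aemeasurable (hψ.1.mono_ac hac),
    integral_withDensity_eq_integral_toReal_smul₀ hφ.1.aemeasurable.ennreal_ofReal
      (by simp)]
  simp [ENNReal.toReal_ofReal', smul_eq_mul]

theorem integrable_pushDensity_mul {f φ ψ : ℝ → ℝ}
    (hφ : Integrable φ leb) (hψ : MemLp ψ ∞ leb) :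
    Integrable (fun x => pushDensity f φ x * ψ x) leb := by
  have h1 := isFiniteMeasure_push hφ f
  have : Integrable (pushDensity f φ) leb := Measure.integrable_toReal_rnDeriv
  exact this.mul_of_top_left hψ

/-- The duality relation `∫ (L_f φ) ψ dm = ∫ φ (ψ ∘ f) dm` for `φ ∈ L¹`, `ψ ∈ L^∞`, which
characterizes the transfer operator. -/
theorem integral_transfer_mul {f φ ψ : ℝ → ℝ} (hf : Measurable f) (hns : leb.map f ≪ leb)
    (hφ : Integrable φ leb) (hψ : MemLp ψ ∞ leb) :
    ∫ x, transfer f φ x * ψ x ∂leb = ∫ x, φ x * ψ (f x) ∂leb := by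
  have hψf : MemLp (fun x => ψ (f x)) ∞ leb :=
    ⟨(hψ.1.mono_ac hns).comp_measurable hf, by
      refine lt_of_le_of_lt ?_ hψ.2
      rw [eLpNorm_exponent_top, eLpNorm_exponent_top]
      refine essSup_le_of_ae_le _ ?_
      exact ae_of_ae_map hf.aemeasurable (hns.ae_le (enorm_ae_le_eLpNormEssSup ψ leb))⟩
  have i1 : Integrable (fun x => max (φ x) 0 * ψ (f x)) leb := hφ.pos_part.mul_of_top_left hψf
  have i2 : Integrable (fun x => max (-φ x) 0 * ψ (f x)) leb := hφ.neg.pos_part.mul_of_top_left hψf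
  have e1 := integral_pushDensity_mul hf hns hφ hψ
  have e2 := integral_pushDensity_mul hf hns hφ.neg hψ
  have e : ∀ x, transfer f φ x * ψ x
      = pushDensity f φ x * ψ x - pushDensity f (fun y => -φ y) x * ψ x := fun x => by
    simp only [transfer]; ring
  simp only [e]
  have e2' : ∫ x, pushDensity f (fun y => -φ y) x * ψ x ∂leb
      = ∫ x, max (-φ x) 0 * ψ (f x) ∂leb := e2
  have j2 : Integrable (fun x => pushDensity f (fun y => -φ y) x * ψ x) leb :=
    integrable_pushDensity_mul hφ.neg hψ
  rw [integral_sub (integrable_pushDensity_mul hφ hψ) j2, e1, e2']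
  rw [← integral_sub i1 i2]
  refine integral_congr_ae (Filter.Eventually.of_forall fun x => ?_)
  simp only
  rcases le_total (φ x) 0 with h | h
  · rw [max_eq_right h, max_eq_left (by linarith)]; ring
  · rw [max_eq_left h, max_eq_right (by linarith)]; ring

end Duality

end RandomLY

/-!
Write `v φ = var φ` and `l φ = ‖φ‖₁`. The proof couples a Lasota–Yorke inequality, which contracts
`v` at the expense of `l`, with the lower bound on the images of the cone, which contracts `l`.

Iterating the `N`-step inequality along the orbit gives, over blocks of any length `M` that is a
positive multiple of `N`, `v (L φ) ≤ α v φ + C l φ` (`realVar_transferIter_mul_le`), while `l` never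
increases. Put `A = 2 C / (1 - α)`. If `φ` has mean zero and `v φ ≤ A l φ`, then the positive and
the negative part of `φ` have the same mass `l φ / 2` and lie in the cone with constant `2 A`; for a
suitable `M` the images of both exceed `(c / 2) (l φ / 2)`, and this common mass cancels, so that
`l (L φ) ≤ (1 - c / 2) l φ` (`normOne_transferIter_le_of_realVar_le`). Consider now
`w = max (v, A l)`, a norm equivalent to the `BV` norm. A block contracts `v` relative to `w`, by
the factor `(1 + α) / 2`. After one block either `A l` dominates `v`, and the next block contracts
`l`, or `A l` is smaller than the already contracted `v`. Hence two blocks contract `w` by a fixed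
factor (`max_transferIter_two_blocks_le`), for a.e. `ω`, which is exponential decay along the
multiples of `2 M`.

The remaining `r < 2 M` steps require that a single `L_ω` be bounded on `BV` uniformly in `ω`. This
is not part of the `N`-step inequality; it follows from the uniform bounds on the number of branches,
on `1 / |f_ω'|` and on `f_ω''` (`IsLasotaYorkeMap.var_transfer_le`), through the explicit formula
`L h = ∑ i, 1_{f (I i)} · (h / |f'|) ∘ (f|_{I i})⁻¹`. The formula is derived from the change of
variables formula, and each term is estimated by extending the inverse branch monotonically and the
weight `1 / |f'|` as a Lipschitz function.
-/

open MeasureTheory Set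
open scoped ENNReal

namespace RandomLY

/-! ### Total variation on an interval -/

instance isProbabilityMeasure_leb : IsProbabilityMeasure leb := ⟨by simp [leb]⟩

theorem eVariationOn_add_le (u v : ℝ → ℝ) (s : Set ℝ) :
    eVariationOn (fun x => u x + v x) s ≤ eVariationOn u s + eVariationOn v s := by
  refine iSup_le fun ⟨n, p, hp, hps⟩ => ?_
  refine le_trans ?_ (add_le_add (eVariationOn.sum_le (f := u) (n := n) hp hps)
    (eVariationOn.sum_le (f := v) (n := n) hp hps))
  rw [← Finset.sum_add_distrib]
  exact Finset.sum_le_sum fun i _ => edist_add_add_le _ _ _ _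

theorem eVariationOn_sum_le {ι : Type*} (t : Finset ι) (u : ι → ℝ → ℝ) (s : Set ℝ) :
    eVariationOn (fun x => ∑ i ∈ t, u i x) s ≤ ∑ i ∈ t, eVariationOn (u i) s := by
  classical
  induction t using Finset.induction_on with
  | empty =>
    simp only [Finset.sum_empty]
    exact (eVariationOn.eq_zero_iff _).2 (by simp) |>.le
  | insert a t ha ih =>
    simp only [Finset.sum_insert ha]
    exact (eVariationOn_add_le _ _ _).trans (add_le_add le_rfl ih)

theorem eVariationOn_mul_le {u v : ℝ → ℝ} {s : Set ℝ} {A B : ℝ≥0∞}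
    (hu : ∀ x ∈ s, ‖u x‖ₑ ≤ A) (hv : ∀ x ∈ s, ‖v x‖ₑ ≤ B) :
    eVariationOn (fun x => u x * v x) s ≤ A * eVariationOn v s + B * eVariationOn u s := by
  refine iSup_le fun ⟨n, p, hp, hps⟩ => ?_
  refine le_trans ?_ (add_le_add
    (mul_le_mul_right (eVariationOn.sum_le (f := v) (n := n) hp hps) A)
    (mul_le_mul_right (eVariationOn.sum_le (f := u) (n := n) hp hps) B))
  rw [Finset.mul_sum, Finset.mul_sum, ← Finset.sum_add_distrib]
  refine Finset.sum_le_sum fun i _ => ?_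
  simp only [edist_eq_enorm_sub]
  have e : u (p (i + 1)) * v (p (i + 1)) - u (p i) * v (p i)
      = u (p (i + 1)) * (v (p (i + 1)) - v (p i)) + v (p i) * (u (p (i + 1)) - u (p i)) := by ring
  rw [e]
  refine (enorm_add_le _ _).trans ?_
  rw [enorm_mul, enorm_mul]
  exact add_le_add (mul_le_mul_left (hu _ (hps _)) _) (mul_le_mul_left (hv _ (hps _)) _)

theorem eVariationOn_indicator_one_upperSet_le {U : Set ℝ} (hU : IsUpperSet U) :
    eVariationOn (U.indicator (1 : ℝ → ℝ)) (Icc 0 1) ≤ 1 := by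
  have hm : MonotoneOn (U.indicator (1 : ℝ → ℝ)) (Icc 0 1) := by
    intro x _ y _ hxy
    by_cases hx : x ∈ U
    · simp [hx, hU hxy hx]
    · simp only [hx, not_false_eq_true, indicator_of_notMem]
      exact indicator_nonneg (by simp) _
  have := hm.eVariationOn_eq (a := 0) (b := 1) (by simp) (by simp)
  rw [inter_self] at this
  refine this.le.trans ?_
  rw [ENNReal.ofReal_le_one]
  have h1 : U.indicator (1 : ℝ → ℝ) 1 ≤ 1 := indicator_le_self' (by simp) _
  have h0 : 0 ≤ U.indicator (1 : ℝ → ℝ) 0 := indicator_nonneg (by simp) _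
  linarith

theorem eVariationOn_indicator_one_lowerSet_le {L : Set ℝ} (hL : IsLowerSet L) :
    eVariationOn (L.indicator (1 : ℝ → ℝ)) (Icc 0 1) ≤ 1 := by
  refine le_trans (le_of_eq ?_) (eVariationOn_indicator_one_upperSet_le hL.compl)
  have e : L.indicator (1 : ℝ → ℝ) = fun x => 1 - Lᶜ.indicator (1 : ℝ → ℝ) x := by
    funext x
    by_cases hx : x ∈ L <;> simp [hx]
  rw [e]
  simp only [eVariationOn, edist_sub_left]

theorem enorm_indicator_one_le (s : Set ℝ) (x : ℝ) : ‖s.indicator (1 : ℝ → ℝ) x‖ₑ ≤ 1 := by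
  by_cases hx : x ∈ s <;> simp [hx]

/-- The indicator function of an interval has variation at most `2`: it is the product of the
indicators of an upper and of a lower set. -/
theorem eVariationOn_indicator_one_le {J : Set ℝ} (hJ : J.OrdConnected) :
    eVariationOn (J.indicator (1 : ℝ → ℝ)) (Icc 0 1) ≤ 2 := by
  have e : J.indicator (1 : ℝ → ℝ) = fun x => (upperClosure J : Set ℝ).indicator (1 : ℝ → ℝ) x *
      (lowerClosure J : Set ℝ).indicator (1 : ℝ → ℝ) x := by
    conv_lhs => rw [← hJ.upperClosure_inter_lowerClosure]
    rw [inter_indicator_one]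
    rfl
  rw [e]
  refine (eVariationOn_mul_le (A := 1) (B := 1) (fun x _ => enorm_indicator_one_le _ x)
    fun x _ => enorm_indicator_one_le _ x).trans ?_
  rw [one_mul, one_mul, ← one_add_one_eq_two]
  exact add_le_add (eVariationOn_indicator_one_lowerSet_le (lowerClosure J).lower)
    (eVariationOn_indicator_one_upperSet_le (upperClosure J).upper)

theorem eVariationOn_indicator_le {J : Set ℝ} (hJ : J.OrdConnected) {u : ℝ → ℝ} {A : ℝ≥0∞}
    (hu : ∀ x ∈ Icc (0 : ℝ) 1, ‖u x‖ₑ ≤ A) :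
    eVariationOn (J.indicator u) (Icc 0 1) ≤ eVariationOn u (Icc 0 1) + A * 2 := by
  have e : J.indicator u = fun x => J.indicator (1 : ℝ → ℝ) x * u x := by
    funext x
    by_cases hx : x ∈ J <;> simp [hx]
  rw [e]
  refine (eVariationOn_mul_le (A := 1) (B := A) (fun x _ => enorm_indicator_one_le _ x)
    hu).trans ?_
  rw [one_mul]
  exact add_le_add le_rfl (mul_le_mul_right (eVariationOn_indicator_one_le hJ) _)

/-- Variation of the contribution of one branch to the transfer operator: `g` is a monotone
extension of the inverse branch, `w` the weight `1 / |f'|` and `J` the image of the branch. -/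
theorem eVariationOn_indicator_mul_comp_le {J : Set ℝ} (hJ : J.OrdConnected) {h w g : ℝ → ℝ}
    {S W : ℝ≥0∞} (hg : MonotoneOn g (Icc 0 1) ∨ AntitoneOn g (Icc 0 1))
    (hgm : MapsTo g (Icc 0 1) (Icc 0 1)) (hh : ∀ x ∈ Icc (0 : ℝ) 1, ‖h x‖ₑ ≤ S)
    (hw : ∀ x ∈ Icc (0 : ℝ) 1, ‖w x‖ₑ ≤ W) (hhv : eVariationOn h (Icc 0 1) ≤ S)
    (hwv : eVariationOn w (Icc 0 1) ≤ W) :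
    eVariationOn (J.indicator fun y => h (g y) * w (g y)) (Icc 0 1) ≤ 4 * (S * W) := by
  have h1 : eVariationOn (fun y => h (g y) * w (g y)) (Icc 0 1) ≤ S * W + W * S := by
    refine le_trans ?_ ((eVariationOn_mul_le hh hw).trans
      (add_le_add (mul_le_mul_right hwv S) (mul_le_mul_right hhv W)))
    rcases hg with hg | hg
    · exact eVariationOn.comp_le_of_monotoneOn (fun x => h x * w x) g hg hgm
    · exact eVariationOn.comp_le_of_antitoneOn (fun x => h x * w x) g hg hgm
  refine (eVariationOn_indicator_le hJ (A := S * W) fun x hx => ?_).trans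
    ((add_le_add h1 le_rfl).trans (le_of_eq (by ring)))
  rw [enorm_mul]
  exact mul_le_mul' (hh _ (hgm hx)) (hw _ (hgm hx))

/-- A function of bounded variation is bounded by its variation plus its `L¹` norm, since
`|h|` is somewhere at most its mean. -/
theorem enorm_le_eVariationOn_add {h : ℝ → ℝ} (hh : Integrable h leb) {x : ℝ}
    (hx : x ∈ Icc (0 : ℝ) 1) :
    ‖h x‖ₑ ≤ eVariationOn h (Icc 0 1) + eLpNorm h 1 leb := by
  obtain ⟨y, hy, hle⟩ := exists_notMem_null_le_integral (μ := leb) (N := (Icc (0 : ℝ) 1)ᶜ) hh.norm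
    (by simp [leb, measurableSet_Icc.compl])
  rw [notMem_compl_iff] at hy
  have h1 : ‖h y‖ₑ ≤ eLpNorm h 1 leb := by
    rw [eLpNorm_one_eq_lintegral_enorm, ← ofReal_integral_norm_eq_lintegral_enorm hh,
      ← ofReal_norm]
    exact ENNReal.ofReal_le_ofReal hle
  have h2 : ‖h x - h y‖ₑ ≤ eVariationOn h (Icc 0 1) := by
    rw [← edist_eq_enorm_sub]
    exact eVariationOn.edist_le h hx hy
  calc ‖h x‖ₑ = ‖(h x - h y) + h y‖ₑ := by rw [sub_add_cancel]
    _ ≤ _ := (enorm_add_le _ _).trans (add_le_add h2 h1)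

theorem eVariationOn_le_of_lipschitzWith {w : ℝ → ℝ} {C : NNReal} (hw : LipschitzWith C w) :
    eVariationOn w (Icc 0 1) ≤ C := by
  have := (hw.lipschitzOnWith (s := univ)).comp_eVariationOn_le (g := id) (s := Icc (0:ℝ) 1)
    (fun _ _ => mem_univ _)
  rw [eVariationOn_id_Icc] at this
  simpa using this

/-! ### The essential variation -/

theorem var_le_of_ae_eq {g h : ℝ → ℝ} (hg : h =ᵐ[leb] g) : var g ≤ eVariationOn h (Icc 0 1) :=
  iInf₂_le h hg

/-- Post-composition with a `1`-Lipschitz function does not increase the variation. -/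
theorem var_comp_le {T : ℝ → ℝ} (hT : LipschitzWith 1 T) (φ : ℝ → ℝ) :
    var (fun x => T (φ x)) ≤ var φ := by
  refine le_iInf₂ fun h hh => ?_
  have := (hT.lipschitzOnWith (s := univ)).comp_eVariationOn_le (g := h) (s := Icc (0:ℝ) 1)
    (fun _ _ => mem_univ _)
  rw [ENNReal.coe_one, one_mul] at this
  exact (var_le_of_ae_eq (h := T ∘ h) (hh.fun_comp T)).trans this

/-! ### Inverse branches -/

/-- A lower bound that holds almost everywhere on `[0,1]` holds everywhere on an open subset where
the function is continuous. -/
theorem le_of_ae_le_of_continuousOn {U : Set ℝ} (hU : IsOpen U) (hsub : U ⊆ Icc 0 1) {u : ℝ → ℝ}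
    (hu : ContinuousOn u U) {c : ℝ} (hc : ∀ᵐ x ∂leb, c ≤ u x) {x : ℝ} (hx : x ∈ U) : c ≤ u x := by
  by_contra! hlt
  have hopen : IsOpen (U ∩ u ⁻¹' Iio c) := hu.isOpen_inter_preimage hU isOpen_Iio
  have h0 : volume (U ∩ u ⁻¹' Iio c) = 0 := by
    rw [ae_restrict_iff' measurableSet_Icc, ae_iff] at hc
    refine measure_mono_null (fun y hy => ?_) hc
    simp only [mem_ofPred_eq, Classical.not_imp, not_le]
    exact ⟨hsub hy.1, hy.2⟩
  rw [hopen.measure_eq_zero_iff volume] at h0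
  exact (h0 ▸ (⟨hx, hlt⟩ : x ∈ U ∩ u ⁻¹' Iio c) : x ∈ (∅ : Set ℝ))

theorem one_le_abs_deriv {f : ℝ → ℝ} {a b : ℝ} (hf : ContDiffOn ℝ 2 f (Ioo a b))
    (hsub : Ioo a b ⊆ Icc 0 1) (h1 : ∀ᵐ x ∂leb, 1 ≤ |deriv f x|) {x : ℝ} (hx : x ∈ Ioo a b) :
    1 ≤ |deriv f x| :=
  le_of_ae_le_of_continuousOn isOpen_Ioo hsub
    (hf.continuousOn_deriv_of_isOpen isOpen_Ioo (by norm_num)).abs h1 hx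

theorem lipschitzOnWith_deriv {f : ℝ → ℝ} {a b : ℝ} (hf : ContDiffOn ℝ 2 f (Ioo a b))
    (hsub : Ioo a b ⊆ Icc 0 1) {D : NNReal} (hD : ∀ᵐ x ∂leb, |deriv (deriv f) x| ≤ D) :
    LipschitzOnWith D (deriv f) (Ioo a b) := by
  have hf' : ContDiffOn ℝ 1 (deriv f) (Ioo a b) := by
    have := (contDiffOn_succ_iff_deriv_of_isOpen (n := 1) (f := f) isOpen_Ioo).1
      (by norm_num; exact hf)
    exact this.2.2
  refine (convex_Ioo a b).lipschitzOnWith_of_nnnorm_deriv_le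
    (fun x hx => (hf'.differentiableOn (by norm_num)).differentiableAt (Ioo_mem_nhds hx.1 hx.2))
    fun x hx => ?_
  have := le_of_ae_le_of_continuousOn isOpen_Ioo hsub
    (hf'.continuousOn_deriv_of_isOpen isOpen_Ioo (by norm_num)).abs.neg
    (c := -D) (hD.mono fun y hy => neg_le_neg hy) hx
  rw [← NNReal.coe_le_coe, coe_nnnorm, Real.norm_eq_abs]
  exact neg_le_neg_iff.1 this

/-- The weight `1 / |f'|` of a branch extends to a Lipschitz function on the line. -/
theorem exists_weight {f : ℝ → ℝ} {a b : ℝ} (hab : a < b) (hf : ContDiffOn ℝ 2 f (Ioo a b))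
    (hsub : Ioo a b ⊆ Icc 0 1) (h1 : ∀ᵐ x ∂leb, 1 ≤ |deriv f x|)
    {D : NNReal} (hD : ∀ᵐ x ∂leb, |deriv (deriv f) x| ≤ D) :
    ∃ w : ℝ → ℝ, (∀ x ∈ Ioo a b, w x = |deriv f x|⁻¹) ∧
      (∀ x ∈ Icc (0 : ℝ) 1, ‖w x‖ₑ ≤ 1 + D) ∧ eVariationOn w (Icc 0 1) ≤ 1 + D := by
  have hl : LipschitzOnWith D (fun x => |deriv f x|⁻¹) (Ioo a b) := by
    refine LipschitzOnWith.of_dist_le_mul fun x hx y hy => ?_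
    refine le_trans ?_ ((lipschitzOnWith_deriv hf hsub hD).dist_le_mul x hx y hy)
    have hx1 := one_le_abs_deriv hf hsub h1 hx
    have hy1 := one_le_abs_deriv hf hsub h1 hy
    have hxy : 1 ≤ |deriv f x| * |deriv f y| := one_le_mul_of_one_le_of_one_le hx1 hy1
    rw [Real.dist_eq, Real.dist_eq, inv_sub_inv (by positivity) (by positivity), abs_div,
      abs_of_pos (by positivity : 0 < |deriv f x| * |deriv f y|)]
    refine (div_le_self (abs_nonneg _) hxy).trans ?_
    rw [abs_sub_comm (deriv f x)]
    exact abs_abs_sub_abs_le _ _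
  obtain ⟨w, hw, hwe⟩ := hl.extend_real
  refine ⟨w, fun x hx => (hwe hx).symm, fun x hx => ?_, ?_⟩
  · obtain ⟨y, hy⟩ : (Ioo a b).Nonempty := nonempty_Ioo.2 hab
    have hwy : ‖w y‖ₑ ≤ 1 := by
      rw [← hwe hy, ← ofReal_norm, ENNReal.ofReal_le_one, Real.norm_eq_abs, abs_inv, abs_abs]
      exact inv_le_one_of_one_le₀ (one_le_abs_deriv hf hsub h1 hy)
    have hd : ‖w x - w y‖ₑ ≤ D := by
      rw [← edist_eq_enorm_sub]
      refine (hw x y).trans ?_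
      refine mul_le_of_le_one_right' ?_
      rw [edist_dist, ENNReal.ofReal_le_one]
      simpa using Real.dist_le_of_mem_Icc hx (hsub hy)
    calc ‖w x‖ₑ = ‖w y + (w x - w y)‖ₑ := by rw [add_sub_cancel]
      _ ≤ _ := (enorm_add_le _ _).trans (add_le_add hwy hd)
  · exact (eVariationOn_le_of_lipschitzWith hw).trans le_add_self

/-- The inverse of a strictly monotone branch, extended monotonically to `[0,1]`. -/
theorem exists_monotone_inverse {f : ℝ → ℝ} {I : Set ℝ} (hsub : I ⊆ Icc 0 1)
    (hf : StrictMonoOn f I ∨ StrictAntiOn f I) :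
    ∃ g : ℝ → ℝ, (MonotoneOn g (Icc 0 1) ∨ AntitoneOn g (Icc 0 1)) ∧
      MapsTo g (Icc 0 1) (Icc 0 1) ∧ ∀ x ∈ I, g (f x) = x := by
  have hinj : InjOn f I := hf.elim StrictMonoOn.injOn StrictAntiOn.injOn
  have hinv : ∀ x ∈ I, Function.invFunOn f I (f x) = x := fun x hx => hinj.leftInvOn_invFunOn hx
  have himg : Function.invFunOn f I '' (f '' I) ⊆ Icc 0 1 := by
    rintro _ ⟨_, ⟨x, hx, rfl⟩, rfl⟩
    rw [hinv x hx]
    exact hsub hx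
  have hlo : BddBelow (Function.invFunOn f I '' (f '' I)) := bddBelow_Icc.mono himg
  have hup : BddAbove (Function.invFunOn f I '' (f '' I)) := bddAbove_Icc.mono himg
  -- Clamping to `[0,1]` makes the extension a self-map of `[0,1]`.
  have hclamp : Monotone fun y : ℝ => max 0 (min 1 y) := fun x y hxy =>
    max_le_max le_rfl (min_le_min le_rfl hxy)
  have hmaps : ∀ e : ℝ → ℝ, MapsTo (fun y => max 0 (min 1 (e y))) (Icc 0 1) (Icc (0 : ℝ) 1) :=
    fun e y _ => ⟨le_max_left _ _, max_le zero_le_one (min_le_left _ _)⟩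
  have hleft : ∀ e : ℝ → ℝ, EqOn e (Function.invFunOn f I) (f '' I) →
      ∀ x ∈ I, max 0 (min 1 (e (f x))) = x := fun e he x hx => by
    rw [he (mem_image_of_mem f hx), hinv x hx, min_eq_right (hsub hx).2, max_eq_right (hsub hx).1]
  rcases hf with hf | hf
  · have hm : MonotoneOn (Function.invFunOn f I) (f '' I) := by
      rintro _ ⟨x, hx, rfl⟩ _ ⟨y, hy, rfl⟩ hxy
      rw [hinv x hx, hinv y hy]
      exact (hf.le_iff_le hx hy).1 hxy
    obtain ⟨e, he, hee⟩ := hm.exists_monotone_extension hlo hup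
    exact ⟨_, Or.inl ((hclamp.comp he).monotoneOn _), hmaps e, hleft e hee.symm⟩
  · have hm : AntitoneOn (Function.invFunOn f I) (f '' I) := by
      rintro _ ⟨x, hx, rfl⟩ _ ⟨y, hy, rfl⟩ hxy
      rw [hinv x hx, hinv y hy]
      exact (hf.le_iff_ge hx hy).1 hxy
    obtain ⟨e, he, hee⟩ := hm.exists_antitone_extension hlo hup
    exact ⟨_, Or.inr ((hclamp.comp_antitone he).antitoneOn _), hmaps e, hleft e hee.symm⟩

/-- The part of `leb` over a branch, transported by the change of variables formula. -/
theorem setIntegral_branch {f g w h : ℝ → ℝ} {a b : ℝ} (hf : ContDiffOn ℝ 2 f (Ioo a b))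
    (hfm : Measurable f) (hinj : InjOn f (Ioo a b)) (hsub : Ioo a b ⊆ Icc 0 1)
    (hmaps : MapsTo f (Icc 0 1) (Icc 0 1)) (h1 : ∀ᵐ x ∂leb, 1 ≤ |deriv f x|)
    (hg : ∀ x ∈ Ioo a b, g (f x) = x) (hw : ∀ x ∈ Ioo a b, w x = |deriv f x|⁻¹)
    (hh : Integrable h leb) :
    Integrable ((f '' Ioo a b).indicator fun y => h (g y) * w (g y)) leb ∧
    ∀ s, MeasurableSet s →
      ∫ y in s, (f '' Ioo a b).indicator (fun y => h (g y) * w (g y)) y ∂leb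
        = ∫ x in f ⁻¹' s ∩ Ioo a b, h x := by
  have hJ : MeasurableSet (f '' Ioo a b) :=
    ((isPreconnected_Ioo.image f hf.continuousOn).ordConnected).measurableSet
  have hJsub : f '' Ioo a b ⊆ Icc 0 1 := (hmaps.mono_left hsub).image_subset
  have hderiv : ∀ x ∈ Ioo a b, HasDerivWithinAt f (deriv f x) (Ioo a b) x := fun x hx =>
    ((hf.differentiableOn (by norm_num)).differentiableAt
      (Ioo_mem_nhds hx.1 hx.2)).hasDerivAt.hasDerivWithinAt
  have hsimp : ∀ x ∈ Ioo a b, |deriv f x| • (h (g (f x)) * w (g (f x))) = h x := fun x hx => by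
    have := one_le_abs_deriv hf hsub h1 hx
    rw [hg x hx, hw x hx, smul_eq_mul]
    field_simp
  constructor
  · rw [integrable_indicator_iff hJ, IntegrableOn, leb, Measure.restrict_restrict hJ,
      inter_eq_self_of_subset_left hJsub]
    refine (integrableOn_image_iff_integrableOn_abs_deriv_smul measurableSet_Ioo hderiv hinj _).2 ?_
    refine IntegrableOn.congr_fun (f := h) ?_ (fun x hx => (hsimp x hx).symm) measurableSet_Ioo
    exact (show IntegrableOn h (Icc 0 1) volume from hh).mono_set hsub
  · intro s hs
    rw [setIntegral_indicator hJ, leb, Measure.restrict_restrict (hs.inter hJ),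
      inter_eq_self_of_subset_left (inter_subset_right.trans hJsub), ← image_preimage_inter,
      integral_image_eq_integral_abs_deriv_smul ((hfm hs).inter measurableSet_Ioo)
        (fun x hx => (hderiv x hx.2).mono inter_subset_right) (hinj.mono inter_subset_right)]
    exact setIntegral_congr_fun ((hfm hs).inter measurableSet_Ioo) fun x hx => hsimp x hx.2

theorem branch_subset {k : ℕ} {t : Fin (k + 1) → ℝ} (ht : StrictMono t) (h0 : t 0 = 0)
    (h1 : t (Fin.last k) = 1) (i : Fin k) : Ioo (t i.castSucc) (t i.succ) ⊆ Icc 0 1 := by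
  refine Ioo_subset_Icc_self.trans (Icc_subset_Icc ?_ ?_)
  · rw [← h0]; exact ht.monotone (Fin.zero_le _)
  · rw [← h1]; exact ht.monotone (Fin.le_last _)

theorem pairwise_disjoint_branches {k : ℕ} {t : Fin (k + 1) → ℝ} (ht : StrictMono t) :
    Pairwise (Function.onFun Disjoint fun i : Fin k => Ioo (t i.castSucc) (t i.succ)) := by
  have key : ∀ i j : Fin k, i < j →
      Disjoint (Ioo (t i.castSucc) (t i.succ)) (Ioo (t j.castSucc) (t j.succ)) := fun i j hij => by
    refine disjoint_left.2 fun x hx hy => ?_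
    have : t i.succ ≤ t j.castSucc := ht.monotone (by
      rw [Fin.le_def]; simpa using hij)
    exact absurd (hx.2.trans_le this) (not_lt.2 hy.1.le)
  intro i j hij
  rcases lt_or_gt_of_ne hij with h | h
  · exact key i j h
  · exact (key j i h).symm

/-- The branches exhaust `[0,1]` up to the finitely many break points. -/
theorem iUnion_branches_ae_eq {k : ℕ} {t : Fin (k + 1) → ℝ} (ht : StrictMono t) (h0 : t 0 = 0)
    (h1 : t (Fin.last k) = 1) :
    (⋃ i : Fin k, Ioo (t i.castSucc) (t i.succ)) =ᵐ[volume] Icc (0 : ℝ) 1 := by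
  refine (iUnion_subset fun i => branch_subset ht h0 h1 i).eventuallyLE.antisymm ?_
  rw [ae_le_set]
  refine measure_mono_null (t := range t) (fun x hx => ?_) ((finite_range t).measure_zero _)
  by_contra hxt
  refine hx.2 (mem_iUnion.2 ?_)
  -- The last break point below `x` is the left end of its branch.
  have hne : (Finset.univ.filter fun j : Fin (k + 1) => t j ≤ x).Nonempty :=
    ⟨0, by simpa [h0] using hx.1.1⟩
  set j := (Finset.univ.filter fun j : Fin (k + 1) => t j ≤ x).max' hne with hj
  have hjx : t j ≤ x := by
    have := Finset.max'_mem _ hne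
    simpa using this
  have hjlt : t j < x := lt_of_le_of_ne hjx fun h => hxt ⟨j, h⟩
  have hjl : j ≠ Fin.last k := fun h => by
    rw [h, h1] at hjlt
    exact absurd hx.1.2 (not_le.2 hjlt)
  refine ⟨j.castPred hjl, ?_⟩
  refine ⟨by simpa using hjlt, ?_⟩
  by_contra! hle
  have hmem : (j.castPred hjl).succ ∈ Finset.univ.filter fun j : Fin (k + 1) => t j ≤ x := by
    simpa using hle
  have := Finset.le_max' _ _ hmem
  rw [← hj, Fin.le_def] at this
  simp at this

/-! ### The transfer operator of a single map -/

/-- A piecewise `C²` self-map of `[0,1]` with at most `b` monotone branches, with `|f'| ≥ 1` and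
`|f''| ≤ D`. Only these bounds enter the estimate of the transfer operator on `BV` by a constant
that is uniform in the family. -/
structure IsLasotaYorkeMap (b : ℕ) (D : NNReal) (f : ℝ → ℝ) : Prop where
  measurable : Measurable f
  mapsTo : MapsTo f (Icc 0 1) (Icc 0 1)
  branches : ∃ k ≤ b, HasBranches f k
  one_le_abs_deriv : ∀ᵐ x ∂leb, 1 ≤ |deriv f x|
  abs_deriv2_le : ∀ᵐ x ∂leb, |deriv (deriv f) x| ≤ D

/-- An expanding piecewise smooth map is nonsingular. -/
theorem IsLasotaYorkeMap.map_absolutelyContinuous {b : ℕ} {D : NNReal} {f : ℝ → ℝ}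
    (hf : IsLasotaYorkeMap b D f) : leb.map f ≪ leb := by
  obtain ⟨k, -, t, ht, h0, h1, hbr⟩ := hf.branches
  refine Measure.AbsolutelyContinuous.mk fun s hs hs0 => ?_
  rw [leb, Measure.restrict_apply hs] at hs0
  rw [Measure.map_apply hf.measurable hs, leb,
    ← Measure.restrict_congr_set (iUnion_branches_ae_eq ht h0 h1),
    Measure.restrict_apply (hf.measurable hs), inter_iUnion, measure_iUnion_null_iff]
  intro i
  have hsub := branch_subset ht h0 h1 i
  obtain ⟨hC, hmono⟩ := hbr i
  have hinj : InjOn f (Ioo (t i.castSucc) (t i.succ)) :=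
    hmono.elim StrictMonoOn.injOn StrictAntiOn.injOn
  set A := f ⁻¹' s ∩ Ioo (t i.castSucc) (t i.succ) with hA
  have hAm : MeasurableSet A := (hf.measurable hs).inter measurableSet_Ioo
  have himg : volume (f '' A) = 0 := by
    refine measure_mono_null ?_ hs0
    rintro _ ⟨x, hx, rfl⟩
    exact ⟨hx.1, hf.mapsTo (hsub hx.2)⟩
  have hcov := lintegral_image_eq_lintegral_abs_deriv_mul hAm (f' := deriv f)
    (fun x hx => ((hC.differentiableOn (by norm_num)).differentiableAt
      (Ioo_mem_nhds hx.2.1 hx.2.2)).hasDerivAt.hasDerivWithinAt)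
    (hinj.mono inter_subset_right) 1
  simp only [Pi.one_apply, mul_one, lintegral_one, Measure.restrict_apply_univ, himg] at hcov
  refine le_antisymm (le_trans ?_ hcov.ge) zero_le
  calc volume A = ∫⁻ _ in A, 1 := by simp
    _ ≤ ∫⁻ x in A, ENNReal.ofReal |deriv f x| := setLIntegral_mono' hAm fun x hx => by
        rw [ENNReal.one_le_ofReal]
        exact RandomLY.one_le_abs_deriv hC hsub hf.one_le_abs_deriv hx.2

theorem setIntegral_transfer {f φ : ℝ → ℝ} (hf : Measurable f) (hns : leb.map f ≪ leb)
    (hφ : Integrable φ leb) {s : Set ℝ} (hs : MeasurableSet s) :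
    ∫ x in s, transfer f φ x ∂leb = ∫ x in f ⁻¹' s, φ x ∂leb := by
  have hψ : MemLp (s.indicator fun _ => (1 : ℝ)) ∞ leb := (memLp_top_const 1).indicator hs
  have := integral_transfer_mul hf hns hφ hψ
  rw [← integral_indicator hs, ← integral_indicator (hf hs)]
  convert this using 1
  · refine integral_congr_ae (.of_forall fun x => ?_)
    by_cases hx : x ∈ s <;> simp [hx]
  · refine integral_congr_ae (.of_forall fun x => ?_)
    by_cases hx : f x ∈ s <;> simp [hx]

theorem transfer_ae_eq_of_setIntegral {f φ F : ℝ → ℝ} (hf : Measurable f) (hns : leb.map f ≪ leb)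
    (hφ : Integrable φ leb) (hF : Integrable F leb)
    (h : ∀ s, MeasurableSet s → ∫ x in s, F x ∂leb = ∫ x in f ⁻¹' s, φ x ∂leb) :
    F =ᵐ[leb] transfer f φ :=
  hF.ae_eq_of_forall_setIntegral_eq _ _ (integrable_transfer hφ f) fun s hs _ => by
    rw [h s hs, setIntegral_transfer hf hns hφ hs]

theorem transfer_sub_ae_eq {f φ ψ : ℝ → ℝ} (hf : Measurable f) (hns : leb.map f ≪ leb)
    (hφ : Integrable φ leb) (hψ : Integrable ψ leb) :
    (fun x => transfer f φ x - transfer f ψ x) =ᵐ[leb] transfer f fun x => φ x - ψ x := by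
  have i1 := integrable_transfer hφ f
  have i2 := integrable_transfer hψ f
  refine transfer_ae_eq_of_setIntegral hf hns (hφ.sub hψ) (i1.sub i2) fun s hs => ?_
  rw [integral_sub i1.integrableOn i2.integrableOn, integral_sub hφ.integrableOn hψ.integrableOn,
    setIntegral_transfer hf hns hφ hs, setIntegral_transfer hf hns hψ hs]

theorem transfer_congr_ae {f φ ψ : ℝ → ℝ} (hf : Measurable f) (hns : leb.map f ≪ leb)
    (hφ : Integrable φ leb) (h : φ =ᵐ[leb] ψ) : transfer f φ =ᵐ[leb] transfer f ψ :=
  transfer_ae_eq_of_setIntegral hf hns (hφ.congr h) (integrable_transfer hφ f) fun s hs => by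
    rw [setIntegral_transfer hf hns hφ hs]
    exact integral_congr_ae (ae_restrict_of_ae h)

theorem transfer_nonneg {f φ : ℝ → ℝ} (hf : Measurable f) (hns : leb.map f ≪ leb)
    (hφ : Integrable φ leb) (h : 0 ≤ᵐ[leb] φ) : 0 ≤ᵐ[leb] transfer f φ :=
  ae_nonneg_of_forall_setIntegral_nonneg (integrable_transfer hφ f) fun s hs _ => by
    rw [setIntegral_transfer hf hns hφ hs]
    exact integral_nonneg_of_ae (ae_restrict_of_ae h)

theorem integral_transfer {f φ : ℝ → ℝ} (hf : Measurable f) (hns : leb.map f ≪ leb)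
    (hφ : Integrable φ leb) : ∫ x, transfer f φ x ∂leb = ∫ x, φ x ∂leb := by
  simpa using setIntegral_transfer hf hns hφ MeasurableSet.univ

/-- One step of the transfer operator is bounded from `BV` to the space of functions of finite
variation: `L h` is the sum over the branches of `(h / |f'|) ∘ f_i⁻¹` on the image of the branch,
and each term has variation at most `4 (1 + D) (var h + ‖h‖₁)`. -/
theorem IsLasotaYorkeMap.var_transfer_le {b : ℕ} {D : NNReal} {f φ : ℝ → ℝ}
    (hf : IsLasotaYorkeMap b D f) (hφ : Integrable φ leb) :
    var (transfer f φ) ≤ (b * 4 * (1 + D) : ℝ≥0∞) * bvNorm φ := by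
  have hns := hf.map_absolutelyContinuous
  obtain ⟨k, hk, t, ht, h0, h1, hbr⟩ := hf.branches
  have key : ∀ h : ℝ → ℝ, h =ᵐ[leb] φ → var (transfer f φ) ≤
      (b * 4 * (1 + D) : ℝ≥0∞) * (eVariationOn h (Icc 0 1) + eLpNorm φ 1 leb) := by
    intro h hhφ
    have hh : Integrable h leb := hφ.congr hhφ.symm
    have hsub := branch_subset ht h0 h1
    have hlt : ∀ i : Fin k, t i.castSucc < t i.succ := fun i => ht Fin.castSucc_lt_succ
    choose w hw hwb hwv using fun i : Fin k => exists_weight (hlt i) (hbr i).1 (hsub i)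
      hf.one_le_abs_deriv hf.abs_deriv2_le
    choose g hgm hgmaps hg using fun i : Fin k => exists_monotone_inverse (hsub i) (hbr i).2
    have hinj : ∀ i : Fin k, InjOn f (Ioo (t i.castSucc) (t i.succ)) := fun i =>
      (hbr i).2.elim StrictMonoOn.injOn StrictAntiOn.injOn
    have hF := fun i : Fin k => setIntegral_branch (hbr i).1 hf.measurable (hinj i) (hsub i)
      hf.mapsTo hf.one_le_abs_deriv (hg i) (hw i) hh
    set F : Fin k → ℝ → ℝ := fun i => (f '' Ioo (t i.castSucc) (t i.succ)).indicator
      fun y => h (g i y) * w i (g i y) with hFdef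
    have hsum : (fun y => ∑ i, F i y) =ᵐ[leb] transfer f φ := by
      refine transfer_ae_eq_of_setIntegral hf.measurable hns hφ
        (integrable_finsetSum _ fun i _ => (hF i).1) fun s hs => ?_
      rw [integral_finsetSum _ fun i _ => (hF i).1.integrableOn,
        integral_congr_ae (ae_restrict_of_ae hhφ.symm),
        leb, ← Measure.restrict_congr_set (iUnion_branches_ae_eq ht h0 h1),
        Measure.restrict_restrict (hf.measurable hs), inter_iUnion, integral_iUnion_fintype
          (fun i => (hf.measurable hs).inter measurableSet_Ioo)
          (fun i j hij => (pairwise_disjoint_branches ht hij).mono inter_subset_right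
            inter_subset_right)
          (fun i => (show IntegrableOn h (Icc 0 1) volume from hh).mono_set
            (inter_subset_right.trans (hsub i)))]
      refine Finset.sum_congr rfl fun i _ => ?_
      rw [Measure.restrict_congr_set (iUnion_branches_ae_eq ht h0 h1)]
      exact (hF i).2 s hs
    refine (var_le_of_ae_eq hsum).trans ((eVariationOn_sum_le _ _ _).trans ?_)
    have hnorm : eLpNorm h 1 leb = eLpNorm φ 1 leb := eLpNorm_congr_ae hhφ
    have hterm : ∀ i ∈ Finset.univ, eVariationOn (F i) (Icc 0 1) ≤
        4 * ((eVariationOn h (Icc 0 1) + eLpNorm φ 1 leb) * (1 + D)) := fun i _ =>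
      eVariationOn_indicator_mul_comp_le
        ((isPreconnected_Ioo.image f (hbr i).1.continuousOn).ordConnected) (hgm i) (hgmaps i)
        (fun x hx => hnorm ▸ enorm_le_eVariationOn_add hh hx) (hwb i) le_self_add (hwv i)
    refine (Finset.sum_le_card_nsmul _ _ _ hterm).trans ?_
    rw [Finset.card_univ, Fintype.card_fin, nsmul_eq_mul]
    calc (k : ℝ≥0∞) * (4 * ((eVariationOn h (Icc 0 1) + eLpNorm φ 1 leb) * (1 + D)))
        ≤ b * (4 * ((eVariationOn h (Icc 0 1) + eLpNorm φ 1 leb) * (1 + D))) :=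
          mul_le_mul_left (by exact_mod_cast hk) _
      _ = _ := by ring
  -- The constant is finite, so the bound passes to the infimum over the representatives `h`.
  have hfin : (b * 4 * (1 + D) : ℝ≥0∞) ≠ ∞ := by finiteness
  rw [bvNorm, show var φ = ⨅ h : {h : ℝ → ℝ // h =ᵐ[leb] φ}, eVariationOn h.1 (Icc 0 1) from
    iInf_subtype', ENNReal.iInf_add]
  have : Nonempty {h : ℝ → ℝ // h =ᵐ[leb] φ} := ⟨⟨φ, .rfl⟩⟩
  rw [ENNReal.mul_iInf fun h => absurd h hfin]
  exact le_iInf fun h => key h.1 h.2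

/-! ### Norms as real numbers -/

/-- The variation as a real number; only meaningful for functions of finite variation. -/
noncomputable def realVar (φ : ℝ → ℝ) : ℝ := (var φ).toReal

/-- The `L¹([0,1])` norm as a real number; only meaningful for integrable functions. -/
noncomputable def normOne (φ : ℝ → ℝ) : ℝ := ∫ x, |φ x| ∂leb

theorem realVar_nonneg (φ : ℝ → ℝ) : 0 ≤ realVar φ := ENNReal.toReal_nonneg

theorem normOne_nonneg (φ : ℝ → ℝ) : 0 ≤ normOne φ := integral_nonneg fun _ => abs_nonneg _

theorem ofReal_realVar {φ : ℝ → ℝ} (hφ : φ ∈ BV) : ENNReal.ofReal (realVar φ) = var φ :=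
  ENNReal.ofReal_toReal hφ.2.ne

theorem ofReal_normOne {φ : ℝ → ℝ} (hφ : Integrable φ leb) :
    ENNReal.ofReal (normOne φ) = eLpNorm φ 1 leb := by
  rw [eLpNorm_one_eq_lintegral_enorm, ← ofReal_integral_norm_eq_lintegral_enorm hφ]
  rfl

theorem bvNorm_eq_ofReal {φ : ℝ → ℝ} (hφ : φ ∈ BV) :
    bvNorm φ = ENNReal.ofReal (realVar φ + normOne φ) := by
  rw [ENNReal.ofReal_add (realVar_nonneg _) (normOne_nonneg _), ofReal_realVar hφ,
    ofReal_normOne hφ.1, bvNorm]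

theorem lipschitzWith_max_zero : LipschitzWith 1 fun x : ℝ => max x 0 :=
  LipschitzWith.id.max_const 0

theorem lipschitzWith_max_neg_zero : LipschitzWith 1 fun x : ℝ => max (-x) 0 :=
  (LipschitzWith.id.neg).max_const 0

/-! ### Iterates -/

section Iterates

variable {Ω : Type*} {σ : Ω → Ω} {f : Ω → ℝ → ℝ} {b : ℕ} {D : NNReal}

theorem transferIter_add (m n : ℕ) (ω : Ω) (φ : ℝ → ℝ) :
    transferIter σ f (m + n) ω φ = transferIter σ f n (σ^[m] ω) (transferIter σ f m ω φ) := by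
  induction n with
  | zero => rfl
  | succ n ih =>
    change transfer (f (σ^[m + n] ω)) (transferIter σ f (m + n) ω φ) = _
    rw [ih, add_comm m n, Function.iterate_add_apply]
    rfl

theorem integrable_transferIter (n : ℕ) (ω : Ω) {φ : ℝ → ℝ} (hφ : Integrable φ leb) :
    Integrable (transferIter σ f n ω φ) leb := by
  induction n with
  | zero => exact hφ
  | succ n ih => exact integrable_transfer ih _

theorem integral_transferIter (hf : ∀ ω, IsLasotaYorkeMap b D (f ω)) (n : ℕ) (ω : Ω) {φ : ℝ → ℝ}
    (hφ : Integrable φ leb) : ∫ x, transferIter σ f n ω φ x ∂leb = ∫ x, φ x ∂leb := by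
  induction n with
  | zero => rfl
  | succ n ih =>
    rw [← ih]
    exact integral_transfer (hf _).measurable (hf _).map_absolutelyContinuous
      (integrable_transferIter n ω hφ)

theorem transferIter_nonneg (hf : ∀ ω, IsLasotaYorkeMap b D (f ω)) (n : ℕ) (ω : Ω) {φ : ℝ → ℝ}
    (hφ : Integrable φ leb) (h : 0 ≤ᵐ[leb] φ) : 0 ≤ᵐ[leb] transferIter σ f n ω φ := by
  induction n with
  | zero => exact h
  | succ n ih =>
    exact transfer_nonneg (hf _).measurable (hf _).map_absolutelyContinuous
      (integrable_transferIter n ω hφ) ih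

theorem transferIter_sub_ae_eq (hf : ∀ ω, IsLasotaYorkeMap b D (f ω)) (n : ℕ) (ω : Ω)
    {φ ψ : ℝ → ℝ} (hφ : Integrable φ leb) (hψ : Integrable ψ leb) :
    (fun x => transferIter σ f n ω φ x - transferIter σ f n ω ψ x) =ᵐ[leb]
      transferIter σ f n ω fun x => φ x - ψ x := by
  induction n with
  | zero => rfl
  | succ n ih =>
    have hm := (hf (σ^[n] ω)).measurable
    have hns := (hf (σ^[n] ω)).map_absolutelyContinuous
    have i1 := integrable_transferIter (σ := σ) (f := f) n ω hφ
    have i2 := integrable_transferIter (σ := σ) (f := f) n ω hψ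
    exact (transfer_sub_ae_eq hm hns i1 i2).trans (transfer_congr_ae hm hns (i1.sub i2) ih)

/-- If the images of the positive and the negative part of `φ` are both at least `κ`, then they
cancel on a common mass `κ`. -/
theorem normOne_transferIter_le (hf : ∀ ω, IsLasotaYorkeMap b D (f ω)) (n : ℕ) (ω : Ω)
    {φ : ℝ → ℝ} (hφ : Integrable φ leb) {κ : ℝ}
    (hp : ∀ᵐ x ∂leb, κ ≤ transferIter σ f n ω (fun y => max (φ y) 0) x)
    (hn : ∀ᵐ x ∂leb, κ ≤ transferIter σ f n ω (fun y => max (-φ y) 0) x) :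
    normOne (transferIter σ f n ω φ) ≤ normOne φ - 2 * κ := by
  have ip : Integrable (fun y => max (φ y) 0) leb := hφ.pos_part
  have im : Integrable (fun y => max (-φ y) 0) leb := hφ.neg_part
  have jp := integrable_transferIter (σ := σ) (f := f) n ω ip
  have jm := integrable_transferIter (σ := σ) (f := f) n ω im
  have hsplit := transferIter_sub_ae_eq (σ := σ) hf n ω ip im
  simp only [max_zero_sub_max_neg_zero_eq_self] at hsplit
  have hle : ∀ᵐ x ∂leb, |transferIter σ f n ω φ x| ≤
      transferIter σ f n ω (fun y => max (φ y) 0) x +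
        transferIter σ f n ω (fun y => max (-φ y) 0) x - 2 * κ := by
    filter_upwards [hp, hn, hsplit] with x h1 h2 h3
    rw [← h3, abs_le]
    constructor <;> linarith
  refine (integral_mono_ae (integrable_transferIter n ω hφ).abs
    ((jp.add jm).sub (integrable_const _)) hle).trans (le_of_eq ?_)
  rw [integral_sub' (jp.add jm) (integrable_const _), integral_add' jp jm,
    integral_transferIter hf n ω ip, integral_transferIter hf n ω im, ← integral_add ip im,
    integral_const, normOne]
  simp only [max_zero_add_max_neg_zero_eq_abs_self, probReal_univ, one_smul]

theorem normOne_transferIter_le_self (hf : ∀ ω, IsLasotaYorkeMap b D (f ω)) (n : ℕ) (ω : Ω)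
    {φ : ℝ → ℝ} (hφ : Integrable φ leb) : normOne (transferIter σ f n ω φ) ≤ normOne φ := by
  have := normOne_transferIter_le (σ := σ) hf n ω hφ (κ := 0)
    (transferIter_nonneg hf n ω hφ.pos_part (.of_forall fun _ => le_max_right _ _))
    (transferIter_nonneg hf n ω hφ.neg_part (.of_forall fun _ => le_max_right _ _))
  simpa using this

theorem transferIter_mem_BV (hf : ∀ ω, IsLasotaYorkeMap b D (f ω)) (n : ℕ) (ω : Ω) {φ : ℝ → ℝ}
    (hφ : φ ∈ BV) : transferIter σ f n ω φ ∈ BV := by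
  induction n with
  | zero => exact hφ
  | succ n ih =>
    refine ⟨integrable_transfer ih.1 _, ((hf _).var_transfer_le ih.1).trans_lt ?_⟩
    rw [bvNorm_eq_ofReal ih]
    finiteness

/-- Iterates are bounded on `BV`, uniformly in the family. -/
theorem realVar_add_normOne_transferIter_le (hf : ∀ ω, IsLasotaYorkeMap b D (f ω)) (n : ℕ) (ω : Ω)
    {φ : ℝ → ℝ} (hφ : φ ∈ BV) :
    realVar (transferIter σ f n ω φ) + normOne (transferIter σ f n ω φ) ≤
      (b * 4 * (1 + D) + 1 : ℝ) ^ n * (realVar φ + normOne φ) := by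
  induction n with
  | zero => simp [transferIter]
  | succ n ih =>
    set ψ := transferIter σ f n ω φ with hψ
    have hψB : ψ ∈ BV := transferIter_mem_BV hf n ω hφ
    have hmem : transfer (f (σ^[n] ω)) ψ ∈ BV := transferIter_mem_BV (σ := σ) hf (n + 1) ω hφ
    have hl : normOne (transfer (f (σ^[n] ω)) ψ) ≤ normOne ψ :=
      normOne_transferIter_le_self (σ := σ) hf 1 (σ^[n] ω) hψB.1
    have hv : realVar (transfer (f (σ^[n] ω)) ψ) ≤ b * 4 * (1 + D) * (realVar ψ + normOne ψ) := by
      have h := (hf (σ^[n] ω)).var_transfer_le hψB.1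
      have h0 : (0 : ℝ) ≤ realVar ψ + normOne ψ := add_nonneg (realVar_nonneg _) (normOne_nonneg _)
      have := ENNReal.toReal_mono (by rw [bvNorm_eq_ofReal hψB]; finiteness) h
      rw [bvNorm_eq_ofReal hψB, ENNReal.toReal_mul, ENNReal.toReal_ofReal h0, ENNReal.toReal_mul,
        ENNReal.toReal_add (by simp) (by simp), ENNReal.toReal_mul] at this
      simpa [realVar] using this
    have h0 := realVar_nonneg ψ
    calc _ ≤ (b * 4 * (1 + D) + 1 : ℝ) * (realVar ψ + normOne ψ) := by
          change realVar (transfer _ ψ) + normOne (transfer _ ψ) ≤ _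
          linarith
      _ ≤ (b * 4 * (1 + D) + 1 : ℝ) * ((b * 4 * (1 + D) + 1 : ℝ) ^ n * (realVar φ + normOne φ)) :=
          mul_le_mul_of_nonneg_left ih (by positivity)
      _ = _ := by ring

/-- Iterating the `N`-step Lasota–Yorke inequality along the orbit of `ω`. -/
theorem realVar_transferIter_mul_le (hf : ∀ ω, IsLasotaYorkeMap b D (f ω)) {N : ℕ} {α K : ℝ}
    (hα0 : 0 < α) (hα1 : α < 1) {ω : Ω}
    (hLY : ∀ n, ∀ φ ∈ BV,
      realVar (transferIter σ f N (σ^[n] ω) φ) ≤ α * realVar φ + K * normOne φ)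
    (hK : 0 < K) {φ : ℝ → ℝ} (hφ : φ ∈ BV) (k : ℕ) :
    realVar (transferIter σ f (N * k) ω φ) ≤ α ^ k * realVar φ + K / (1 - α) * normOne φ := by
  have h1α : 0 < 1 - α := by linarith
  induction k with
  | zero =>
    have := mul_nonneg (div_nonneg hK.le h1α.le) (normOne_nonneg φ)
    simpa [transferIter] using this
  | succ k ih =>
    rw [Nat.mul_succ, transferIter_add]
    refine (hLY _ _ (transferIter_mem_BV hf _ ω hφ)).trans ?_
    have hl := normOne_transferIter_le_self (σ := σ) hf (N * k) ω hφ.1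
    calc _ ≤ α * (α ^ k * realVar φ + K / (1 - α) * normOne φ) + K * normOne φ :=
          add_le_add (mul_le_mul_of_nonneg_left ih hα0.le) (mul_le_mul_of_nonneg_left hl hK.le)
      _ = _ := by field_simp; ring

/-- On the mean zero functions with `var φ ≤ A ‖φ‖₁` the lower bound for the images of the cone
yields a contraction of the `L¹` norm, because both parts of `φ` lie in the cone. -/
theorem normOne_transferIter_le_of_realVar_le (hf : ∀ ω, IsLasotaYorkeMap b D (f ω)) {M : ℕ}
    {A c : ℝ} {ω : Ω}
    (hmin : ∀ h ∈ cone (2 * A), ∀ᵐ x ∂leb, c / 2 * (∫ y, |h y| ∂leb) ≤ transferIter σ f M ω h x)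
    {φ : ℝ → ℝ} (hφ : φ ∈ BV) (h0 : ∫ x, φ x ∂leb = 0) (hA : realVar φ ≤ A * normOne φ) :
    normOne (transferIter σ f M ω φ) ≤ (1 - c / 2) * normOne φ := by
  have ip : Integrable (fun y => max (φ y) 0) leb := hφ.1.pos_part
  have im : Integrable (fun y => max (-φ y) 0) leb := hφ.1.neg_part
  have hsum : ∫ x, max (φ x) 0 ∂leb + ∫ x, max (-φ x) 0 ∂leb = normOne φ := by
    rw [← integral_add ip im, normOne]
    simp only [max_zero_add_max_neg_zero_eq_abs_self]
  have hdiff : ∫ x, max (φ x) 0 ∂leb - ∫ x, max (-φ x) 0 ∂leb = 0 := by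
    rw [← integral_sub ip im]
    simp only [max_zero_sub_max_neg_zero_eq_self, h0]
  -- Each of the two parts carries half of the mass, which doubles the constant of the cone.
  have key : ∀ T : ℝ → ℝ, LipschitzWith 1 T → (∀ x, 0 ≤ T x) → Integrable (fun x => T (φ x)) leb →
      ∫ x, T (φ x) ∂leb = normOne φ / 2 →
      ∀ᵐ x ∂leb, c / 2 * (normOne φ / 2) ≤ transferIter σ f M ω (fun y => T (φ y)) x := by
    intro T hT hT0 hTi hTint
    have hv := var_comp_le hT φ
    have hcone : (fun x => T (φ x)) ∈ cone (2 * A) := by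
      refine ⟨⟨hTi, hv.trans_lt hφ.2⟩, .of_forall fun x => hT0 _, hv.trans ?_⟩
      rw [hTint, ← ofReal_realVar hφ]
      exact ENNReal.ofReal_le_ofReal (by linarith)
    have := hmin _ hcone
    simp only [abs_of_nonneg (hT0 _), hTint] at this
    exact this
  have := normOne_transferIter_le (σ := σ) hf M ω hφ.1
    (key _ lipschitzWith_max_zero (fun _ => le_max_right _ _) ip (by linarith))
    (key _ lipschitzWith_max_neg_zero (fun _ => le_max_right _ _) im (by linarith))
  linarith

/-- Two blocks of length `M` contract `max (var φ) (A ‖φ‖₁)` on mean zero functions: the variation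
is contracted by each block, and `‖φ‖₁` is contracted by the second block if it dominates after
the first one, and else it is bounded by the contracted variation. -/
theorem max_transferIter_two_blocks_le (hf : ∀ ω, IsLasotaYorkeMap b D (f ω)) {M : ℕ}
    {α C A c ρ : ℝ} (hα0 : 0 < α) (hC : 0 < C) (hA : C = (1 - α) / 2 * A) (hA0 : 0 < A)
    (hρ : (1 + α) / 2 ≤ ρ) (hρc : 1 - c / 2 ≤ ρ) {ω : Ω}
    (hLY : ∀ i, ∀ φ ∈ BV,
      realVar (transferIter σ f M (σ^[i] ω) φ) ≤ α * realVar φ + C * normOne φ)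
    (hmin : ∀ i, ∀ h ∈ cone (2 * A),
      ∀ᵐ x ∂leb, c / 2 * (∫ y, |h y| ∂leb) ≤ transferIter σ f M (σ^[i] ω) h x)
    {φ : ℝ → ℝ} (hφ : φ ∈ BV) (h0 : ∫ x, φ x ∂leb = 0) :
    max (realVar (transferIter σ f (M + M) ω φ)) (A * normOne (transferIter σ f (M + M) ω φ)) ≤
      ρ * max (realVar φ) (A * normOne φ) := by
  rw [transferIter_add]
  set ψ := transferIter σ f M ω φ with hψ
  set χ := transferIter σ f M (σ^[M] ω) ψ with hχ
  have hψB : ψ ∈ BV := transferIter_mem_BV hf M ω hφ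
  have hψ0 : ∫ x, ψ x ∂leb = 0 := by rw [hψ, integral_transferIter hf M ω hφ.1, h0]
  have hψv : realVar ψ ≤ α * realVar φ + C * normOne φ := hLY 0 φ hφ
  have hχv : realVar χ ≤ α * realVar ψ + C * normOne ψ := hLY M ψ hψB
  have hψl : normOne ψ ≤ normOne φ := normOne_transferIter_le_self hf M ω hφ.1
  have hχl : normOne χ ≤ normOne ψ := normOne_transferIter_le_self hf M _ hψB.1
  set w := max (realVar φ) (A * normOne φ) with hw
  have hwv : realVar φ ≤ w := le_max_left _ _
  have hwl : A * normOne φ ≤ w := le_max_right _ _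
  have hw0 : 0 ≤ w := (realVar_nonneg φ).trans hwv
  have hα1 : 0 < 1 - α := by
    by_contra! h
    nlinarith
  have hρ0 : 0 ≤ ρ := by linarith
  have step : ∀ v l : ℝ, v ≤ w → A * l ≤ w → α * v + C * l ≤ ρ * w := by
    intro v l hv hl
    have h1 : α * v ≤ α * w := mul_le_mul_of_nonneg_left hv hα0.le
    have h2 : C * l ≤ (1 - α) / 2 * w := by
      rw [hA, mul_assoc]
      exact mul_le_mul_of_nonneg_left hl (by linarith)
    have h3 : (1 + α) / 2 * w ≤ ρ * w := mul_le_mul_of_nonneg_right hρ hw0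
    linarith
  have hψw : realVar ψ ≤ ρ * w := hψv.trans (step _ _ hwv hwl)
  have hAψ : A * normOne ψ ≤ w := (mul_le_mul_of_nonneg_left hψl hA0.le).trans hwl
  have hψw' : realVar ψ ≤ w := by
    have h1 : α * realVar φ ≤ α * w := mul_le_mul_of_nonneg_left hwv hα0.le
    have h2 : C * normOne φ ≤ (1 - α) / 2 * w := by
      rw [hA, mul_assoc]
      exact mul_le_mul_of_nonneg_left hwl (by linarith)
    have h3 : 0 ≤ (1 - α) / 2 * w := by positivity
    linarith
  refine max_le (hχv.trans (step _ _ hψw' hAψ)) ?_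
  rcases le_or_gt (realVar ψ) (A * normOne ψ) with hcase | hcase
  · have hc := normOne_transferIter_le_of_realVar_le (σ := σ) hf (hmin M) hψB hψ0 hcase
    calc A * normOne χ ≤ A * ((1 - c / 2) * normOne ψ) := mul_le_mul_of_nonneg_left hc hA0.le
      _ = (1 - c / 2) * (A * normOne ψ) := by ring
      _ ≤ ρ * (A * normOne ψ) :=
          mul_le_mul_of_nonneg_right hρc (mul_nonneg hA0.le (normOne_nonneg _))
      _ ≤ ρ * w := mul_le_mul_of_nonneg_left hAψ hρ0
  · exact ((mul_le_mul_of_nonneg_left hχl hA0.le).trans hcase.le).trans hψw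

theorem max_transferIter_blocks_le (hf : ∀ ω, IsLasotaYorkeMap b D (f ω)) {M : ℕ}
    {α C A c ρ : ℝ} (hα0 : 0 < α) (hC : 0 < C) (hA : C = (1 - α) / 2 * A) (hA0 : 0 < A)
    (hρ : (1 + α) / 2 ≤ ρ) (hρc : 1 - c / 2 ≤ ρ) {ω : Ω}
    (hLY : ∀ i, ∀ φ ∈ BV,
      realVar (transferIter σ f M (σ^[i] ω) φ) ≤ α * realVar φ + C * normOne φ)
    (hmin : ∀ i, ∀ h ∈ cone (2 * A),
      ∀ᵐ x ∂leb, c / 2 * (∫ y, |h y| ∂leb) ≤ transferIter σ f M (σ^[i] ω) h x)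
    {φ : ℝ → ℝ} (hφ : φ ∈ BV) (h0 : ∫ x, φ x ∂leb = 0) (q : ℕ) :
    max (realVar (transferIter σ f ((M + M) * q) ω φ))
        (A * normOne (transferIter σ f ((M + M) * q) ω φ)) ≤
      ρ ^ q * max (realVar φ) (A * normOne φ) := by
  induction q with
  | zero => simp [transferIter]
  | succ q ih =>
    rw [Nat.mul_succ, transferIter_add]
    refine (max_transferIter_two_blocks_le (ω := σ^[(M + M) * q] ω) hf hα0 hC hA hA0 hρ hρc
      (fun i => ?_) (fun i => ?_) (transferIter_mem_BV hf _ ω hφ) ?_).trans ?_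
    · rw [← Function.iterate_add_apply]
      exact hLY _
    · rw [← Function.iterate_add_apply]
      exact hmin _
    · rw [integral_transferIter hf _ ω hφ.1, h0]
    · rw [pow_succ', mul_assoc]
      exact mul_le_mul_of_nonneg_left ih (by linarith)

end Iterates

/-! ### Exponential decay -/

/-- The lower bound on the images of the cone fails at time `0`, as witnessed by the indicator
function of `[0, 1/2]`. -/
theorem not_forall_cone_two_le {c : ℝ} (hc : 0 < c) :
    ¬ ∀ h ∈ cone 2, ∀ᵐ x ∂leb, c / 2 * (∫ y, |h y| ∂leb) ≤ h x := by
  intro H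
  have hI : leb.real (Iic (1 / 2)) = 1 / 2 := by
    rw [measureReal_restrict_apply measurableSet_Iic, inter_comm,
      show Icc (0 : ℝ) 1 ∩ Iic (1 / 2) = Icc 0 (1 / 2) from ?_]
    · norm_num [Measure.real]
    · ext x
      simp only [mem_inter_iff, mem_Icc, mem_Iic]
      constructor
      · rintro ⟨⟨h1, -⟩, h2⟩
        exact ⟨h1, h2⟩
      · rintro ⟨h1, h2⟩
        exact ⟨⟨h1, by linarith⟩, h2⟩
  have hint : ∫ y, (Iic (1 / 2 : ℝ)).indicator (1 : ℝ → ℝ) y ∂leb = 1 / 2 := by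
    rw [integral_indicator_one measurableSet_Iic, hI]
  have hvar : var ((Iic (1 / 2 : ℝ)).indicator (1 : ℝ → ℝ)) ≤ 1 :=
    (var_le_of_ae_eq .rfl).trans (eVariationOn_indicator_one_lowerSet_le (isLowerSet_Iic _))
  have hnn : ∀ y, 0 ≤ (Iic (1 / 2 : ℝ)).indicator (1 : ℝ → ℝ) y :=
    fun y => indicator_nonneg (by simp) y
  have h := H ((Iic (1 / 2 : ℝ)).indicator (1 : ℝ → ℝ))
    ⟨⟨(integrable_const (1 : ℝ)).indicator measurableSet_Iic, hvar.trans_lt (by simp)⟩,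
      .of_forall hnn, by rw [hint]; simpa using hvar⟩
  simp only [abs_of_nonneg (hnn _), hint] at h
  have h0 : leb (Ioc (1 / 2) 1) = 0 := by
    refine measure_mono_null (fun x hx => ?_) (ae_iff.1 h)
    rw [mem_ofPred_eq, indicator_of_notMem (by simpa using hx.1)]
    linarith
  rw [leb, Measure.restrict_apply measurableSet_Ioc,
    inter_eq_self_of_subset_left (Ioc_subset_Icc_self.trans (Icc_subset_Icc (by norm_num) le_rfl)),
    Real.volume_Ioc] at h0
  norm_num at h0

theorem IsRandomLasotaYorke.exists_isLasotaYorkeMap {Ω : Type*} [MeasurableSpace Ω]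
    {P : Measure Ω} {f : Ω → ℝ → ℝ} (hf : IsRandomLasotaYorke P f) :
    ∃ (b : ℕ) (D : NNReal), ∀ ω, IsLasotaYorkeMap b D (f ω) := by
  obtain ⟨b, hb⟩ := hf.branches
  obtain ⟨δ, hδ, hexp⟩ := hf.expanding
  obtain ⟨D, hD⟩ := hf.bounded_deriv2
  exact ⟨b, D.toNNReal, fun ω => ⟨hf.measurable.of_uncurry_left, hf.mapsTo ω, hb ω,
    (hexp ω).mono fun x hx => hδ.le.trans hx,
    (hD ω).mono fun x hx => hx.trans (Real.le_coe_toNNReal D)⟩⟩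

end RandomLY

open RandomLY

theorem lemma2p3 {Ω : Type*} [MeasurableSpace Ω] (P : MeasureTheory.Measure Ω)
    [MeasureTheory.IsProbabilityMeasure P] (σ : Ω ≃ᵐ Ω) (hσ : Ergodic σ P)
    (f : Ω → ℝ → ℝ) (hf : RandomLY.IsRandomLasotaYorke P f)
    (hLY : RandomLY.UniformLasotaYorke P σ f) (hMin : RandomLY.UniformMin P σ f) :
    ∃ K : ℝ, 0 < K ∧ ∃ lam : ℝ, 0 < lam ∧
      ∀ᵐ ω ∂P, ∀ n : ℕ, ∀ φ ∈ RandomLY.BV, (∫ x, φ x ∂(RandomLY.leb)) = 0 →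
        RandomLY.bvNorm (RandomLY.transferIter σ f n ω φ) ≤
          ENNReal.ofReal (K * Real.exp (-lam * n)) * RandomLY.bvNorm φ := by
  obtain ⟨b, D, hmap⟩ := hf.exists_isLasotaYorkeMap
  obtain ⟨N, hN, α, hα0, hα1, K₀, hK₀, hLYae⟩ := hLY
  obtain ⟨N', hN'⟩ := hMin
  have h1α : 0 < 1 - α := by linarith
  -- For `N' = 0` the lower bound would concern the identity operator, where it fails.
  have hN'0 : 0 < N' := by
    refine Nat.pos_of_ne_zero fun h => ?_
    obtain ⟨n₀, hn₀⟩ := hN' 2 two_pos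
    obtain ⟨c, hc, hae⟩ := hn₀ n₀ le_rfl
    obtain ⟨ω, hω⟩ := hae.exists
    rw [h, zero_mul] at hω
    exact not_forall_cone_two_le hc hω
  set C := K₀ / (1 - α) with hCdef
  have hC : 0 < C := div_pos hK₀ h1α
  set A := 2 * C / (1 - α) with hAdef
  have hA0 : 0 < A := by positivity
  have hA : C = (1 - α) / 2 * A := by rw [hAdef]; field_simp
  obtain ⟨n₀, hn₀⟩ := hN' (2 * A) (by positivity)
  obtain ⟨c, hc, hminae⟩ := hn₀ (N * (n₀ + 1))
    ((Nat.le_succ n₀).trans (Nat.le_mul_of_pos_left _ hN))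
  -- The block length is a multiple both of `N'` and of `N`.
  set M := N' * (N * (n₀ + 1)) with hMdef
  have hM : M = N * (N' * (n₀ + 1)) := by rw [hMdef]; ring
  have hM0 : 0 < M := by positivity
  have hMM : (0 : ℝ) < ((M + M : ℕ) : ℝ) := by exact_mod_cast Nat.add_pos_left hM0 M
  set ρ := max ((1 + α) / 2) (1 - c / 2) with hρdef
  have hρ0 : 0 < ρ := lt_max_of_lt_left (by linarith)
  have hρ1 : ρ < 1 := max_lt (by linarith) (by linarith)
  set B : ℝ := b * 4 * (1 + D) + 1 with hBdef
  have hB1 : 1 ≤ B := le_add_of_nonneg_left (by positivity)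
  set lam := -Real.log ρ / ((M + M : ℕ) : ℝ) with hlam
  have hlam0 : 0 < lam := div_pos (neg_pos.2 (Real.log_neg hρ0 hρ1)) hMM
  refine ⟨B ^ (M + M) * ((1 + 1 / A) * (1 + A)) * ρ⁻¹, by positivity, lam, hlam0, ?_⟩
  have horbit : ∀ {p : Ω → Prop}, (∀ᵐ ω ∂P, p ω) → ∀ᵐ ω ∂P, ∀ i : ℕ, p (σ^[i] ω) := fun hp =>
    ae_all_iff.2 fun i => (hσ.toMeasurePreserving.iterate i).quasiMeasurePreserving.ae hp
  filter_upwards [horbit hLYae, horbit hminae] with ω hω₁ hω₂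
  have hstep : ∀ i, ∀ φ ∈ BV,
      realVar (transferIter σ f N (σ^[i] ω) φ) ≤ α * realVar φ + K₀ * normOne φ := by
    intro i φ hφ
    have h := hω₁ i φ hφ
    rw [← ofReal_realVar hφ, ← ofReal_normOne hφ.1, ← ENNReal.ofReal_mul hα0.le,
      ← ENNReal.ofReal_mul hK₀.le, ← ENNReal.ofReal_add
        (mul_nonneg hα0.le (realVar_nonneg _)) (mul_nonneg hK₀.le (normOne_nonneg _))] at h
    exact ENNReal.toReal_le_of_le_ofReal (add_nonneg
        (mul_nonneg hα0.le (realVar_nonneg _)) (mul_nonneg hK₀.le (normOne_nonneg _))) h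
  have hblock : ∀ i, ∀ φ ∈ BV,
      realVar (transferIter σ f M (σ^[i] ω) φ) ≤ α * realVar φ + C * normOne φ := by
    intro i φ hφ
    rw [hM]
    refine (realVar_transferIter_mul_le hmap hα0 hα1 (fun j => ?_) hK₀ hφ _).trans ?_
    · rw [← Function.iterate_add_apply]
      exact hstep _
    · refine add_le_add (mul_le_mul_of_nonneg_right ?_ (realVar_nonneg _)) le_rfl
      exact pow_le_of_le_one hα0.le hα1.le (by positivity)
  intro n φ hφ h0
  set q := n / (M + M) with hq
  set r := n % (M + M) with hr
  have hr_lt : r < M + M := Nat.mod_lt _ (by omega)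
  have hn : (M + M) * q + r = n := Nat.div_add_mod _ _
  have hdecay := max_transferIter_blocks_le hmap hα0 hC hA hA0 (le_max_left _ _) (le_max_right _ _)
    hblock hω₂ hφ h0 q
  have hφn := transferIter_mem_BV (σ := σ) hmap n ω hφ
  have hrest := realVar_add_normOne_transferIter_le (σ := σ) hmap r (σ^[(M + M) * q] ω)
    (transferIter_mem_BV (σ := σ) hmap ((M + M) * q) ω hφ)
  rw [← transferIter_add, hn] at hrest
  set ψ := transferIter σ f ((M + M) * q) ω φ with hψ
  -- The norm `max (var φ) (A ‖φ‖₁)` is equivalent to the `BV` norm.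
  have hψle : realVar ψ + normOne ψ ≤
      (1 + 1 / A) * max (realVar ψ) (A * normOne ψ) := by
    have h1 := le_max_left (realVar ψ) (A * normOne ψ)
    have h2 : normOne ψ ≤ 1 / A * max (realVar ψ) (A * normOne ψ) := by
      rw [one_div, ← div_eq_inv_mul, le_div_iff₀' hA0]
      exact le_max_right _ _
    linarith
  have hφle : max (realVar φ) (A * normOne φ) ≤ (1 + A) * (realVar φ + normOne φ) := by
    have h1 := realVar_nonneg φ
    have h2 := normOne_nonneg φ
    have h3 := mul_nonneg hA0.le h1
    have h4 := mul_nonneg hA0.le h2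
    exact max_le (by linarith) (by linarith)
  have hs0 : 0 ≤ realVar φ + normOne φ := add_nonneg (realVar_nonneg _) (normOne_nonneg _)
  have hexp : ρ ^ q ≤ ρ⁻¹ * Real.exp (-lam * n) := by
    -- `n ≤ 2 M (q + 1)`, and `exp (-lam * 2 M) = ρ`.
    have hn_le : (n : ℝ) ≤ ((M + M : ℕ) : ℝ) * (q + 1) := by
      have : n ≤ (M + M) * (q + 1) := by rw [Nat.mul_succ]; omega
      exact_mod_cast this
    have hl : lam * n ≤ -Real.log ρ * (q + 1) := by
      calc lam * n ≤ lam * (((M + M : ℕ) : ℝ) * (q + 1)) :=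
            mul_le_mul_of_nonneg_left hn_le hlam0.le
        _ = _ := by rw [hlam]; field_simp
    have he : ρ ^ (q + 1) ≤ Real.exp (-lam * n) := by
      rw [← Real.exp_log (pow_pos hρ0 (q + 1)), Real.log_pow, Real.exp_le_exp]
      push_cast
      linarith
    calc ρ ^ q = ρ⁻¹ * ρ ^ (q + 1) := by rw [pow_succ]; field_simp
      _ ≤ _ := mul_le_mul_of_nonneg_left he (by positivity)
  rw [bvNorm_eq_ofReal hφn, bvNorm_eq_ofReal hφ, ← ENNReal.ofReal_mul (by positivity)]
  refine ENNReal.ofReal_le_ofReal (hrest.trans ?_)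
  calc B ^ r * (realVar ψ + normOne ψ)
      ≤ B ^ (M + M) * ((1 + 1 / A) * (ρ ^ q * ((1 + A) * (realVar φ + normOne φ)))) := by
        refine mul_le_mul (pow_le_pow_right₀ hB1 hr_lt.le) (hψle.trans ?_)
          (add_nonneg (realVar_nonneg _) (normOne_nonneg _)) (by positivity)
        refine mul_le_mul_of_nonneg_left (hdecay.trans ?_) (by positivity)
        exact mul_le_mul_of_nonneg_left hφle (by positivity)
    _ ≤ B ^ (M + M) * ((1 + 1 / A) *
          ((ρ⁻¹ * Real.exp (-lam * n)) * ((1 + A) * (realVar φ + normOne φ)))) := by gcongr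
    _ = _ := by ring
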